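/- Let $S$ be a countable (finite or infinite) set and let $\Gamma$ be a Coxeter graph with vertex set $S$, that is, the labeled graph encoding a Coxeter matrix $M=(m_{s,t})_{s,t\in S}$: a symmetric matrix with entries in $\mathbb N\cup\{\infty\}$ such that $m_{s,s}=1$ for all $s\in S$ and $m_{s,t}\ge 2$ for all $s\neq t$. For elements $a,b$ of a group and an integer $m\ge 0$ let $\mathrm{Prod}_R(b,a,m)=\cdots aba$ be the alternating product of $a$ and $b$ with $m$ factors whose last factor is $a$. The Artin group of $\Gamma$ is $$A[\Gamma]=\langle S\mid \mathrm{Prod}_R(t,s,m_{s,t})=\mathrm{Prod}_R(s,t,m_{s,t})\ \text{ for } s,t\in S,\ s\ne t,\ m_{s,t}\neq\infty\rangle .$$ The virtual Artin group $\mathrm{VA}[\Gamma]$ is the group presented by the generators $\sigma_s,\tau_s$ ($s\in S$) and the following relations, where $s,t$ range over all elements of $S$ with $s\neq t$ and $m_{s,t}\ne\infty$ in (v1), in (v3) and in the first relation of (v2), and where $s$ ranges over $S$ in the second relation of (v2): - (v1) $\mathrm{Prod}_R(\sigma_t,\sigma_s,m_{s,t})=\mathrm{Prod}_R(\sigma_s,\sigma_t,m_{s,t})$;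 - (v2) $\mathrm{Prod}_R(\tau_t,\tau_s,m_{s,t})=\mathrm{Prod}_R(\tau_s,\tau_t,m_{s,t})$, and $\tau_s^2=1$; - (v3) $\mathrm{Prod}_R(\tau_s,\tau_t,m_{s,t}-1)\,\sigma_s=\sigma_r\,\mathrm{Prod}_R(\tau_s,\tau_t,m_{s,t}-1)$, where $r=s$ if $m_{s,t}$ is even and $r=t$ if $m_{s,t}$ is odd. Then the natural homomorphism $\iota_A:A[\Gamma]\to \mathrm{VA}[\Gamma]$ given by $s\mapsto\sigma_s$ for all $s\in S$ is injective. -/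

import Mathlib

/-! Coxeter graphs are encoded by their Coxeter matrices (Mathlib's `CoxeterMatrix S`), in which
the entry `∞` is represented by `0`; so an off-diagonal entry is either `0` (that is, `∞`) or
at least `2`. -/

namespace VirtualArtin

/-- `prodR b a m` is the alternating product `⋯ a b a` of length `m`, whose last factor is `a`. -/
def prodR {G : Type*} [Monoid G] : G → G → ℕ → G
  | _, _, 0 => 1
  | b, a, m + 1 => prodR a b m * a

theorem map_prodR {G H : Type*} [Monoid G] [Monoid H] (f : G →* H) (b a : G) (m : ℕ) :
    f (prodR b a m) = prodR (f b) (f a) m := by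
  induction m generalizing a b with
  | zero => simp [prodR]
  | succ m ih => simp [prodR, ih]

/-- The relators of the Artin group: one for each relation
`prodR t s m_{s,t} = prodR s t m_{s,t}` with `s ≠ t` and `m_{s,t} ≠ ∞`. -/
def artinRelators {S : Type*} (M : CoxeterMatrix S) : Set (FreeGroup S) :=
  {r | ∃ s t : S, s ≠ t ∧ M s t ≠ 0 ∧
    r = prodR (FreeGroup.of t) (FreeGroup.of s) (M s t) *
      (prodR (FreeGroup.of s) (FreeGroup.of t) (M s t))⁻¹}

/-- The Artin group `A[Γ]`. -/
abbrev ArtinGroup {S : Type*} (M : CoxeterMatrix S) : Type _ :=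
  PresentedGroup (artinRelators M)

/-- The generators of the virtual Artin group: two disjoint copies of `S`. -/
inductive Gen (S : Type*) : Type _
  | sigma (s : S) : Gen S
  | tau (s : S) : Gen S

/-- The letter `σ_s` in the free group on the generators. -/
def fsigma {S : Type*} (s : S) : FreeGroup (Gen S) := FreeGroup.of (Gen.sigma s)

/-- The letter `τ_s` in the free group on the generators. -/
def ftau {S : Type*} (s : S) : FreeGroup (Gen S) := FreeGroup.of (Gen.tau s)

/-- The relators of the virtual Artin group; a relation `u = v` gives the relator `u * v⁻¹`. -/
inductive VirtualArtinRelator {S : Type*} (M : CoxeterMatrix S) : FreeGroup (Gen S) → Prop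
  /-- The Artin relations on the `σ_s`. -/
  | artin (s t : S) (hst : s ≠ t) (hm : M s t ≠ 0) :
      VirtualArtinRelator M
        (prodR (fsigma t) (fsigma s) (M s t) * (prodR (fsigma s) (fsigma t) (M s t))⁻¹)
  /-- The braid relations on the `τ_s`. -/
  | coxeter (s t : S) (hst : s ≠ t) (hm : M s t ≠ 0) :
      VirtualArtinRelator M
        (prodR (ftau t) (ftau s) (M s t) * (prodR (ftau s) (ftau t) (M s t))⁻¹)
  /-- The relations `τ_s ^ 2 = 1`. -/
  | square (s : S) : VirtualArtinRelator M (ftau s ^ 2)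
  /-- The mixed relations. Here `M s t ≥ 2`, so the subtraction is not truncated. -/
  | mixed (s t : S) (hst : s ≠ t) (hm : M s t ≠ 0) :
      VirtualArtinRelator M
        (prodR (ftau s) (ftau t) (M s t - 1) * fsigma s *
          (fsigma (if Even (M s t) then s else t) * prodR (ftau s) (ftau t) (M s t - 1))⁻¹)

/-- The virtual Artin group `VA[Γ]`. -/
abbrev VirtualArtinGroup {S : Type*} (M : CoxeterMatrix S) : Type _ :=
  PresentedGroup {r : FreeGroup (Gen S) | VirtualArtinRelator M r}

/-- The element `σ_s` of `VA[Γ]`. -/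
def sigma {S : Type*} (M : CoxeterMatrix S) (s : S) : VirtualArtinGroup M :=
  PresentedGroup.of (Gen.sigma s)

/-- The `σ_s` satisfy the defining relations of the Artin group. -/
theorem lift_sigma_eq_one {S : Type*} (M : CoxeterMatrix S) (r : FreeGroup S)
    (hr : r ∈ artinRelators M) : FreeGroup.lift (sigma M) r = 1 := by
  obtain ⟨s, t, hst, hm, rfl⟩ := hr
  have h : PresentedGroup.mk {r : FreeGroup (Gen S) | VirtualArtinRelator M r}
      (prodR (fsigma t) (fsigma s) (M s t) * (prodR (fsigma s) (fsigma t) (M s t))⁻¹) = 1 :=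
    PresentedGroup.one_of_mem (VirtualArtinRelator.artin s t hst hm)
  rw [map_mul, map_inv, map_prodR, map_prodR] at h ⊢
  simp only [FreeGroup.lift_apply_of]
  exact h

/-- The natural homomorphism `ι_A : A[Γ] → VA[Γ]`, `s ↦ σ_s`. -/
def iotaA {S : Type*} (M : CoxeterMatrix S) : ArtinGroup M →* VirtualArtinGroup M :=
  PresentedGroup.toGroup (f := sigma M) (lift_sigma_eq_one M)

theorem iotaA_of {S : Type*} (M : CoxeterMatrix S) (s : S) :
    iotaA M (PresentedGroup.of s) = sigma M s :=
  PresentedGroup.toGroup.of _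

end VirtualArtin

/-!
The proof realizes `A[Γ]` as a standard parabolic subgroup of a larger Artin group on which the
Coxeter group acts, and then shows that standard parabolic subgroups of Artin groups are again Artin
groups.

Let `W` be the Coxeter group of `M`. On the set of all `r : W` with `r * r = 1`, the orders of the
products `r * r'` form a Coxeter matrix `involutionMatrix W`, which is invariant under conjugation
by `W`. So `W` acts on the Artin group of this matrix, and `σ_s ↦ s`, `τ_s ↦ s ∈ W` defines a
homomorphism from the virtual Artin group to the semidirect product (`toSemidirect`); the mixed
relations become the conjugation identities `conjInvolution_prodR` in `W`. The composite of `ι_A`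
with it is induced by the inclusion of the simple reflections into the involutions. This inclusion
preserves Coxeter matrices since `s * t` has order exactly `M s t` in `W`
(`CoxeterSystem.orderOf_simple_mul_simple`), which comes from the geometric representation. It
therefore suffices to prove van der Lek's theorem (`ArtinGroup.map_injective`): a full subgraph `X`
of a Coxeter graph induces an injection of Artin groups.

For that theorem, let `W` now be the Coxeter group of the large graph and `W_X` the subgroup
generated by `X`. If a simple reflection `s` fixes a coset `C` in `W ⧸ W_X` with minimal
representative `w`, then `s w = w x` for some `x ∈ X` (`IsMinRep.exists_simple_mul_eq`, from the
exchange property); call `x` the label of `s` at `C`. If `s` moves `C`, the minimal representative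
of the new coset is `s w`, and the label is trivial. This is the set-theoretic retraction of
Artin groups found by Charney and Paris: the generator `s` acts on `A[X] × W ⧸ W_X` by
`(g, C) ↦ (label * g, s C)`, and an element of `A[X]` can be read off from what it does to
`(1, W_X)`.

The Artin relations for this action (`prodR_labelPerm_comm`) are a statement about the bi-infinite
walk `…, C₋₁, C₀, C₁, …` through the cosets that applies `s` and `t` alternately. Its steps that do
not move, if any, form a single residue class modulo the period `N` of `C₀` under `s t`, and the
walk is symmetric about each of them. So the labels met are alternately `x` and `y`, and both the
`m` steps forward and the `m` steps backward, where `m` is the order of `s t`, meet `k = m / N` of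
them: they yield `⋯ x y x` and `⋯ y x y`. Since `x y` is conjugate to `(s t) ^ N`, its order is `k`,
and the Artin relation between `x` and `y` shows that the two products are equal.
-/

/-! ### The orders of products of two simple reflections -/

namespace CoxeterMatrix

open Real Polynomial.Chebyshev Module

variable {B : Type*} (M : CoxeterMatrix B)

/-- The simple coroot attached to `i` in the geometric representation on `B →₀ ℝ`: the functional
`v ↦ 2 ⟨α_i, v⟩` for the form with `⟨α_i, α_j⟩ = -cos (π / M i j)`. An entry `M i j = 0`, which
encodes `∞`, gives `⟨α_i, α_j⟩ = -1`, because `π / 0 = 0`. -/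
noncomputable def coroot (i : B) : Dual ℝ (B →₀ ℝ) :=
  Finsupp.linearCombination ℝ fun j => -2 * cos (π / M i j)

@[simp]
theorem coroot_single (i j : B) :
    M.coroot i (Finsupp.single j 1) = -2 * cos (π / M i j) := by
  simp [coroot]

theorem coroot_self (i : B) : M.coroot i (Finsupp.single i 1) = 2 := by
  simp

/-- The simple reflection attached to `i` in the geometric representation. -/
noncomputable def simpleReflection (i : B) : (B →₀ ℝ) ≃ₗ[ℝ] (B →₀ ℝ) :=
  Module.reflection (M.coroot_self i)

theorem two_lt_of_ne {i j : B} (hij : i ≠ j) (h0 : M i j ≠ 0) (h2 : M i j ≠ 2) : 2 < M i j := by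
  have := M.off_diagonal i j hij
  omega

theorem coroot_mul_coroot_sub_two (i j : B) :
    M.coroot i (Finsupp.single j 1) * M.coroot j (Finsupp.single i 1) - 2 =
      2 * cos (2 * (π / M i j)) := by
  rw [coroot_single, coroot_single, M.symmetric j i, cos_two_mul]
  ring

theorem sin_two_mul_pi_div_pos {m : ℕ} (hm : 2 < m) : 0 < sin (2 * (π / m)) := by
  have hm' : (2 : ℝ) < m := by exact_mod_cast hm
  apply sin_pos_of_pos_of_lt_pi
  · have := pi_pos
    positivity
  · rw [← mul_div_assoc, div_lt_iff₀ (by linarith)]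
    nlinarith [pi_pos]

theorem simpleReflection_mul_pow (i j : B) :
    (M.simpleReflection i * M.simpleReflection j) ^ M i j = 1 := by
  by_cases hij : i = j
  · subst hij
    ext1 v
    simp [simpleReflection, involutive_reflection _ v]
  by_cases h0 : M i j = 0
  · simp [h0]
  apply LinearEquiv.ext
  intro z
  have hS := fun n : ℤ => S_two_mul_real_cos (2 * (π / M i j)) n
  rw [simpleReflection, simpleReflection, reflection_mul_reflection_pow_apply _ _ _ _ _
    (M.coroot_mul_coroot_sub_two i j).symm]
  by_cases h2 : M i j = 2
  · have h2' : M j i = 2 := by rw [M.symmetric, h2]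
    simp only [coroot_single, h2, h2']
    norm_num
    rw [show (2 : ℝ) * (π / 2) = π by ring, cos_pi]
    norm_num
    abel
  have hm := M.two_lt_of_ne hij h0 h2
  have hsin := (sin_two_mul_pi_div_pos hm).ne'
  have hmR : (M i j : ℝ) ≠ 0 := by exact_mod_cast h0
  generalize M i j = m at *
  set θ : ℝ := 2 * (π / m) with hθ
  have hmθ : m * θ = 2 * π := by rw [hθ]; field_simp
  rcases Nat.even_or_odd' m with ⟨k, rfl | rfl⟩
  · have e1 : (((2 * k : ℕ) : ℤ) - 2) / 2 = (k : ℤ) - 1 := by omega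
    have e2 : (((2 * k : ℕ) : ℤ) - 1) / 2 = (k : ℤ) - 1 := by omega
    have hz : (S ℝ ((k : ℤ) - 1)).eval (2 * cos θ) = 0 := by
      have h := hS ((k : ℤ) - 1)
      have hk : (((k : ℤ) - 1 : ℤ) + 1 : ℝ) * θ = π := by
        push_cast at hmθ ⊢
        linarith
      rw [hk, sin_pi] at h
      exact (mul_eq_zero.mp h).resolve_right hsin
    rw [e1, e2, hz]
    simp
  · have e1 : (((2 * k + 1 : ℕ) : ℤ) - 2) / 2 = (k : ℤ) - 1 := by omega
    have e2 : (((2 * k + 1 : ℕ) : ℤ) - 1) / 2 = (k : ℤ) := by omega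
    have e3 : (((2 * k + 1 : ℕ) : ℤ) - 3) / 2 = (k : ℤ) - 1 := by omega
    have e4 : ((2 * k + 1 : ℕ) : ℤ) / 2 = (k : ℤ) := by omega
    have hz : (S ℝ (k : ℤ)).eval (2 * cos θ) + (S ℝ ((k : ℤ) - 1)).eval (2 * cos θ) = 0 := by
      have h := hS ((k : ℤ) - 1)
      have h' := hS (k : ℤ)
      have hk : (((k : ℤ) - 1 : ℤ) + 1 : ℝ) * θ = 2 * π - ((k : ℤ) + 1 : ℝ) * θ := by
        push_cast at hmθ ⊢
        linarith
      rw [hk, sin_two_pi_sub] at h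
      have : ((S ℝ (k : ℤ)).eval (2 * cos θ) + (S ℝ ((k : ℤ) - 1)).eval (2 * cos θ)) * sin θ = 0 := by
        rw [add_mul, h, h']
        ring
      exact (mul_eq_zero.mp this).resolve_right hsin
    rw [e1, e2, e3, e4, hz]
    simp

theorem dvd_of_simpleReflection_mul_pow_eq_one {i j : B} (n : ℕ)
    (h : (M.simpleReflection i * M.simpleReflection j) ^ n = 1) : M i j ∣ n := by
  by_cases hij : i = j
  · subst hij
    simp
  have h1 := LinearEquiv.congr_fun h (Finsupp.single i 1)
  rw [simpleReflection, simpleReflection, reflection_mul_reflection_pow_apply_self _ _ _ _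
    (M.coroot_mul_coroot_sub_two i j).symm] at h1
  have hi := DFunLike.congr_fun h1 i
  have hj := DFunLike.congr_fun h1 j
  have eij : (Finsupp.single i (1 : ℝ) : B →₀ ℝ) j = 0 := by
    simp [hij]
  have eji : (Finsupp.single j (1 : ℝ) : B →₀ ℝ) i = 0 := by
    simp [Ne.symm hij]
  simp only [Finsupp.coe_add, Pi.add_apply, Finsupp.coe_smul, Pi.smul_apply, smul_eq_mul,
    Finsupp.single_eq_same, LinearEquiv.coe_one, id_eq, eij, eji, mul_one, mul_zero, add_zero,
    zero_add, coroot_single] at hi hj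
  rw [M.symmetric j i] at hj
  by_cases h0 : M i j = 0
  · rw [h0] at hj ⊢
    simp [S_eval_two] at hj
    simp [hj]
  by_cases h2 : M i j = 2
  · rw [h2] at hi ⊢
    rw [show (2 : ℝ) * (π / (2 : ℕ)) = π by push_cast; ring, cos_pi,
      show (2 : ℝ) * (-1) = -2 by norm_num, S_eval_neg_two, S_eval_neg_two,
      Int.negOnePow_sub] at hi
    rcases Nat.even_or_odd n with hn | hn
    · exact hn.two_dvd
    · rw [Int.negOnePow_odd _ (by exact_mod_cast hn)] at hi
      norm_num at hi
  have hm := M.two_lt_of_ne hij h0 h2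
  have hsin := (sin_two_mul_pi_div_pos hm).ne'
  have hmR : (M i j : ℝ) ≠ 0 := by exact_mod_cast h0
  have hS := fun n : ℤ => S_two_mul_real_cos (2 * (π / M i j)) n
  have hcos : cos (π / M i j) ≠ 0 := by
    intro hc
    rw [sin_two_mul, hc] at hsin
    simp at hsin
  have hz : (S ℝ ((n : ℤ) - 1)).eval (2 * cos (2 * (π / M i j))) = 0 := by
    simpa [hcos] using hj
  rw [hz, add_zero] at hi
  have h3 := hS n
  have h4 := hS ((n : ℤ) - 1)
  rw [hi, one_mul] at h3
  rw [hz, zero_mul] at h4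
  push_cast at h3 h4
  rw [sub_add_cancel] at h4
  rw [add_mul, sin_add, ← h4, zero_mul, zero_add, one_mul] at h3
  have hc : cos (n * (2 * (π / M i j))) = 1 := by
    apply mul_right_cancel₀ hsin
    rw [one_mul, ← h3]
  obtain ⟨k, hk⟩ := (cos_eq_one_iff _).mp hc
  have hkn : (k : ℝ) * M i j = n := by
    have := pi_ne_zero
    field_simp at hk
    linarith
  have hkn' : k * (M i j : ℤ) = n := by exact_mod_cast hkn
  exact Int.natCast_dvd_natCast.mp ⟨k, by rw [← hkn', mul_comm]⟩

end CoxeterMatrix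

namespace CoxeterSystem

variable {B W : Type*} [Group W] {M : CoxeterMatrix B} (cs : CoxeterSystem M W)

/-- The geometric representation shows that the entries of a Coxeter matrix are the exact orders
of the products of two simple reflections; an infinite order is encoded by `0` on both sides. -/
theorem orderOf_simple_mul_simple (i j : B) : orderOf (cs.simple i * cs.simple j) = M i j := by
  apply Nat.dvd_antisymm
  · exact orderOf_dvd_of_pow_eq_one (cs.simple_mul_simple_pow i j)
  · apply M.dvd_of_simpleReflection_mul_pow_eq_one
    have hl : M.IsLiftable M.simpleReflection := M.simpleReflection_mul_pow
    rw [← cs.lift_apply_simple hl i, ← cs.lift_apply_simple hl j, ← map_mul, ← map_pow,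
      pow_orderOf_eq_one, map_one]

theorem simple_injective : Function.Injective cs.simple := by
  intro i j h
  by_contra hij
  apply M.off_diagonal i j hij
  rw [← cs.orderOf_simple_mul_simple, h, simple_mul_simple_self, orderOf_one]

end CoxeterSystem

namespace CoxeterSystem

variable {B W : Type*} [Group W] {M : CoxeterMatrix B} (cs : CoxeterSystem M W)

/-! ### The exchange property -/

open scoped Classical in
/-- The simple reflection `i` acting on signed elements `(t, ε)` of `W`: it conjugates `t`, and
flips the sign `ε : ZMod 2` exactly when `t` is the simple reflection itself. -/
noncomputable def signedConj (i : B) (x : W × ZMod 2) : W × ZMod 2 :=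
  (cs.simple i * x.1 * cs.simple i, x.2 + if x.1 = cs.simple i then 1 else 0)

theorem signedConj_involutive (i : B) : Function.Involutive (cs.signedConj i) := by
  rintro ⟨t, ε⟩
  have h : cs.simple i * t * cs.simple i = cs.simple i ↔ t = cs.simple i := by
    constructor
    · intro h
      have := congrArg (fun x => cs.simple i * x * cs.simple i) h
      simpa [mul_assoc] using this
    · rintro rfl
      simp
  apply Prod.ext
  · simp [signedConj, mul_assoc]
  · by_cases ht : t = cs.simple i
    · have h2 : ∀ a : ZMod 2, a + 1 + 1 = a := by decide
      simp [signedConj, ht, h2]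
    · simp [signedConj, h, ht]

/-- `signedConj` as a permutation. -/
noncomputable def signedConjPerm (i : B) : Equiv.Perm (W × ZMod 2) :=
  (cs.signedConj_involutive i).toPerm

open scoped Classical in
theorem signedConjPerm_mul_pow_apply (i j : B) (n : ℕ) (x : W × ZMod 2) :
    ((cs.signedConjPerm i * cs.signedConjPerm j) ^ n) x =
      ((cs.simple i * cs.simple j) ^ n * x.1 * ((cs.simple i * cs.simple j) ^ n)⁻¹,
        x.2 + ∑ k ∈ Finset.range (2 * n),
          if x.1 = (cs.simple j * cs.simple i) ^ k * cs.simple j then 1 else 0) := by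
  induction n with
  | zero => simp
  | succ n ih =>
    rw [pow_succ', Equiv.Perm.mul_apply, ih, Equiv.Perm.mul_apply]
    have hinv : ((cs.simple i * cs.simple j) ^ n)⁻¹ = (cs.simple j * cs.simple i) ^ n := by
      simp [← inv_pow]
    have hc : cs.simple j * (cs.simple i * cs.simple j) ^ n =
        (cs.simple j * cs.simple i) ^ n * cs.simple j := by
      have : SemiconjBy (cs.simple j) (cs.simple i * cs.simple j) (cs.simple j * cs.simple i) := by
        simp [SemiconjBy, mul_assoc]
      exact this.pow_right n
    have h1 : (cs.simple i * cs.simple j) ^ n * x.1 * ((cs.simple i * cs.simple j) ^ n)⁻¹ =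
        cs.simple j ↔ x.1 = (cs.simple j * cs.simple i) ^ (2 * n) * cs.simple j := by
      rw [mul_inv_eq_iff_eq_mul, hc, ← eq_inv_mul_iff_mul_eq, hinv, ← mul_assoc, ← pow_add,
        two_mul]
    have h2 : cs.simple j * ((cs.simple i * cs.simple j) ^ n * x.1 *
        ((cs.simple i * cs.simple j) ^ n)⁻¹) * cs.simple j = cs.simple i ↔
          x.1 = (cs.simple j * cs.simple i) ^ (2 * n + 1) * cs.simple j := by
      rw [← eq_mul_inv_iff_mul_eq, inv_simple, ← eq_inv_mul_iff_mul_eq, inv_simple,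
        mul_inv_eq_iff_eq_mul, ← eq_inv_mul_iff_mul_eq, hinv, mul_assoc, mul_assoc, hc,
        two_mul, add_assoc, pow_add, pow_succ']
      simp only [mul_assoc]
    have h3 : 2 * (n + 1) = 2 * n + 1 + 1 := by ring
    rw [h3, Finset.sum_range_succ, Finset.sum_range_succ]
    apply Prod.ext
    · simp [signedConjPerm, signedConj, pow_succ', mul_assoc]
    · simp only [signedConjPerm, Function.Involutive.coe_toPerm, signedConj, h1, h2]
      ring

theorem isLiftable_signedConjPerm : M.IsLiftable cs.signedConjPerm := by
  classical
  intro i j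
  ext1 x
  rw [cs.signedConjPerm_mul_pow_apply, simple_mul_simple_pow, two_mul, Finset.sum_range_add]
  have hp : (cs.simple j * cs.simple i) ^ M i j = 1 := by
    rw [M.symmetric, simple_mul_simple_pow]
  have h2 : ∀ a : ZMod 2, a + a = 0 := CharTwo.add_self_eq_zero
  simp [pow_add, hp, h2]

/-- The action of a Coxeter group on signed elements. -/
noncomputable def signedConjHom : W →* Equiv.Perm (W × ZMod 2) :=
  cs.lift ⟨cs.signedConjPerm, cs.isLiftable_signedConjPerm⟩

theorem signedConjHom_simple (i : B) (x : W × ZMod 2) :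
    cs.signedConjHom (cs.simple i) x = cs.signedConj i x := by
  rw [signedConjHom, lift_apply_simple]
  rfl

open scoped Classical in
/-- The sign change of `t` under the product of a word counts, modulo 2, the occurrences of `t` in
the right inversion sequence of that word. Hence this parity depends on the product only. -/
theorem signedConjHom_wordProd (ω : List B) (x : W × ZMod 2) :
    cs.signedConjHom (cs.wordProd ω) x =
      (cs.wordProd ω * x.1 * (cs.wordProd ω)⁻¹,
        x.2 + ((cs.rightInvSeq ω).count x.1 : ZMod 2)) := by
  induction ω with
  | nil => simp
  | cons i ω ih =>
    have h : cs.wordProd ω * x.1 * (cs.wordProd ω)⁻¹ = cs.simple i ↔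
        (cs.wordProd ω)⁻¹ * cs.simple i * cs.wordProd ω = x.1 := by
      constructor
      · intro h
        rw [← h]
        group
      · intro h
        rw [← h]
        group
    rw [wordProd_cons, map_mul, Equiv.Perm.mul_apply, ih, signedConjHom_simple, signedConj]
    ext
    · simp [mul_assoc]
    · simp only [rightInvSeq, List.count_cons, beq_iff_eq, h]
      split_ifs <;> simp [add_assoc]

theorem signedConjHom_snd (w t : W) (ε : ZMod 2) :
    (cs.signedConjHom w (t, ε)).2 = ε + (cs.signedConjHom w (t, 0)).2 := by
  classical
  obtain ⟨ω, rfl⟩ := cs.wordProd_surjective w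
  simp [signedConjHom_wordProd]

theorem mem_rightInvSeq_of_signedConjHom_ne_zero (ω : List B) (t : W)
    (h : (cs.signedConjHom (cs.wordProd ω) (t, 0)).2 ≠ 0) : t ∈ cs.rightInvSeq ω := by
  classical
  rw [signedConjHom_wordProd] at h
  by_contra hm
  rw [List.count_eq_zero_of_not_mem hm] at h
  simp at h

/-- A simple right descent occurs in the right inversion sequence of every reduced word. -/
theorem simple_mem_rightInvSeq {ω : List B} {i : B}
    (h : cs.IsRightDescent (cs.wordProd ω) i) : cs.simple i ∈ cs.rightInvSeq ω := by
  classical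
  apply mem_rightInvSeq_of_signedConjHom_ne_zero
  intro h0
  obtain ⟨ω', hω', hw⟩ := cs.exists_isReduced (cs.wordProd ω * cs.simple i)
  have hmem : cs.simple i ∈ cs.rightInvSeq ω' := by
    apply mem_rightInvSeq_of_signedConjHom_ne_zero
    rw [← hw, map_mul, Equiv.Perm.mul_apply, signedConjHom_simple]
    simp only [signedConj, simple_mul_simple_self, one_mul, if_true, zero_add]
    rw [signedConjHom_snd, h0]
    decide
  have := (cs.isRightInversion_of_mem_rightInvSeq hω' hmem).2
  rw [← hw, mul_assoc, simple_mul_simple_self, mul_one] at this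
  exact absurd h (by rw [IsRightDescent]; omega)

/-- The exchange property: if `i` is a right descent of the product of a word, then multiplication
by the simple reflection `i` amounts to the deletion of a letter. -/
theorem exists_mul_simple_eq_eraseIdx {ω : List B} {i : B}
    (h : cs.IsRightDescent (cs.wordProd ω) i) :
    ∃ k < ω.length, cs.wordProd ω * cs.simple i = cs.wordProd (ω.eraseIdx k) := by
  obtain ⟨k, hk, hki⟩ := List.getElem_of_mem (cs.simple_mem_rightInvSeq h)
  refine ⟨k, by simpa using hk, ?_⟩
  rw [← wordProd_mul_getD_rightInvSeq, List.getD_eq_getElem _ _ hk, hki]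

/-! ### Cosets of standard parabolic subgroups -/

variable {A : Type*} (ι : A → B)

/-- The standard parabolic subgroup generated by the simple reflections with index in the range
of `ι`. -/
def parabolic : Subgroup W := Subgroup.closure (Set.range (cs.simple ∘ ι))

theorem simple_mem_parabolic (a : A) : cs.simple (ι a) ∈ cs.parabolic ι :=
  Subgroup.subset_closure ⟨a, rfl⟩

theorem wordProd_map_mem_parabolic (L : List A) : cs.wordProd (L.map ι) ∈ cs.parabolic ι := by
  induction L with
  | nil => simp
  | cons a L ih =>
    rw [List.map_cons, wordProd_cons]
    exact mul_mem (cs.simple_mem_parabolic ι a) ih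

theorem exists_wordProd_map_of_mem_parabolic {p : W} (hp : p ∈ cs.parabolic ι) :
    ∃ L : List A, cs.wordProd (L.map ι) = p := by
  induction hp using Subgroup.closure_induction with
  | mem x hx =>
    obtain ⟨a, rfl⟩ := hx
    exact ⟨[a], by simp⟩
  | one => exact ⟨[], by simp⟩
  | mul x y _ _ hx hy =>
    obtain ⟨L, rfl⟩ := hx
    obtain ⟨L', rfl⟩ := hy
    exact ⟨L ++ L', by simp [wordProd_append]⟩
  | inv x _ hx =>
    obtain ⟨L, rfl⟩ := hx
    exact ⟨L.reverse, by rw [List.map_reverse, wordProd_reverse]⟩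

/-- `w` has minimal length in its left coset of the standard parabolic subgroup. -/
def IsMinRep (w : W) : Prop := ∀ p ∈ cs.parabolic ι, cs.length w ≤ cs.length (w * p)

/-- Multiplication of a minimal coset representative by a shortest word in the generators of the
parabolic subgroup adds lengths. -/
theorem length_mul_wordProd_map {w : W} (hw : cs.IsMinRep ι w) (L : List A)
    (hL : ∀ L' : List A, cs.wordProd (L'.map ι) = cs.wordProd (L.map ι) → L.length ≤ L'.length) :
    cs.length (w * cs.wordProd (L.map ι)) = cs.length w + L.length := by
  induction L using List.reverseRecOn with
  | nil => simp
  | append_singleton L a ih =>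
    have hL' : ∀ L' : List A, cs.wordProd (L'.map ι) = cs.wordProd (L.map ι) →
        L.length ≤ L'.length := by
      intro L' h
      have := hL (L' ++ [a]) (by simp [wordProd_append, h])
      simpa using this
    replace ih := ih hL'
    have hsplit : w * cs.wordProd ((L ++ [a]).map ι) =
        w * cs.wordProd (L.map ι) * cs.simple (ι a) := by
      simp [wordProd_append, mul_assoc]
    rw [hsplit]
    rcases cs.length_mul_simple (w * cs.wordProd (L.map ι)) (ι a) with h | h
    · rw [h, ih, List.length_append, List.length_singleton, add_assoc]
    exfalso
    obtain ⟨ω, hω, rfl⟩ := cs.exists_isReduced w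
    have hdesc : cs.IsRightDescent (cs.wordProd (ω ++ L.map ι)) (ι a) := by
      rw [IsRightDescent, wordProd_append]
      omega
    obtain ⟨k, hk, hk'⟩ := cs.exists_mul_simple_eq_eraseIdx hdesc
    by_cases hkω : k < ω.length
    · -- A letter of `w` is deleted: the coset of `w` has an element shorter than `w`.
      rw [List.eraseIdx_append_of_lt_length hkω, wordProd_append, wordProd_append] at hk'
      have hmem : cs.wordProd (L.map ι) * cs.simple (ι a) * (cs.wordProd (L.map ι))⁻¹ ∈
          cs.parabolic ι :=
        mul_mem (mul_mem (cs.wordProd_map_mem_parabolic ι L) (cs.simple_mem_parabolic ι a))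
          (inv_mem (cs.wordProd_map_mem_parabolic ι L))
      have h1 := hw _ hmem
      have h2 : cs.wordProd ω * (cs.wordProd (L.map ι) * cs.simple (ι a) *
          (cs.wordProd (L.map ι))⁻¹) = cs.wordProd (ω.eraseIdx k) := by
        rw [← mul_assoc, ← mul_assoc, hk', mul_inv_cancel_right]
      rw [h2] at h1
      have h3 := cs.length_wordProd_le (ω.eraseIdx k)
      rw [List.length_eraseIdx_of_lt hkω] at h3
      have h4 := hω.eq
      omega
    · -- A letter of the parabolic word is deleted, which makes that word shorter.
      rw [not_lt] at hkω
      rw [List.eraseIdx_append_of_length_le hkω, wordProd_append, wordProd_append, mul_assoc,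
        mul_right_inj, List.eraseIdx_map] at hk'
      have h1 := hL (L.eraseIdx (k - ω.length)) (by rw [← hk']; simp [wordProd_append])
      have h2 := List.length_eraseIdx_le L (k - ω.length)
      simp at h1
      omega

/-- Every `p` in the parabolic subgroup is the product of a word in its generators whose length is
the amount by which `p` lengthens a minimal coset representative. -/
theorem IsMinRep.exists_list {w p : W} (hw : cs.IsMinRep ι w) (hp : p ∈ cs.parabolic ι) :
    ∃ L : List A, p = cs.wordProd (L.map ι) ∧ cs.length (w * p) = cs.length w + L.length := by
  classical
  have hex : ∃ n, ∃ L : List A, L.length = n ∧ cs.wordProd (L.map ι) = p := by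
    obtain ⟨L, hL⟩ := cs.exists_wordProd_map_of_mem_parabolic ι hp
    exact ⟨_, L, rfl, hL⟩
  obtain ⟨L, hlen, hL⟩ := Nat.find_spec hex
  refine ⟨L, hL.symm, ?_⟩
  rw [← hL]
  apply cs.length_mul_wordProd_map ι hw
  intro L' h
  rw [hlen]
  exact Nat.find_min' hex ⟨L', rfl, h.trans hL⟩

theorem IsMinRep.eq_of_mem {w p : W} (hw : cs.IsMinRep ι w) (hp : p ∈ cs.parabolic ι)
    (hwp : cs.IsMinRep ι (w * p)) : w * p = w := by
  obtain ⟨L, rfl, hL⟩ := IsMinRep.exists_list cs ι hw hp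
  have := hwp _ (inv_mem hp)
  rw [mul_inv_cancel_right] at this
  have h0 : L = [] := List.eq_nil_of_length_eq_zero (by omega)
  simp [h0]

/-- If `s w` lies in the coset of the minimal representative `w`, then `s w = w x` for a simple
reflection `x` of the parabolic subgroup. -/
theorem IsMinRep.exists_simple_mul_eq {w p : W} (hw : cs.IsMinRep ι w)
    (hp : p ∈ cs.parabolic ι) {i : B} (h : cs.simple i * w = w * p) :
    ∃ a, cs.simple i * w = w * cs.simple (ι a) := by
  obtain ⟨L, rfl, hL⟩ := IsMinRep.exists_list cs ι hw hp
  have hne := cs.length_simple_mul w i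
  rw [h] at hne
  match L, hL, h with
  | [], hL, _ => simp at hL hne
  | [a], hL, h => exact ⟨a, by simpa using h⟩
  | a :: b :: L, hL, _ =>
    simp only [List.length_cons] at hL
    omega

/-- If `s` moves the coset of the minimal representative `w`, then `s w` is again minimal. -/
theorem IsMinRep.simple_mul {w : W} (hw : cs.IsMinRep ι w) {i : B}
    (h : ∀ p ∈ cs.parabolic ι, cs.simple i * w ≠ w * p) : cs.IsMinRep ι (cs.simple i * w) := by
  intro p hp
  by_contra hlt
  rw [not_le] at hlt
  obtain ⟨L, rfl, hL⟩ := IsMinRep.exists_list cs ι hw hp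
  have hsw := cs.length_simple_mul w i
  have hswp := cs.length_simple_mul (w * cs.wordProd (L.map ι)) i
  rw [mul_assoc] at hlt
  match L, hL, hlt, hswp with
  | [], _, hlt, _ => simp at hlt
  | a :: b :: L, hL, hlt, hswp =>
    rw [List.length_cons, List.length_cons] at hL
    omega
  | [a], hL, hlt, hswp =>
    obtain ⟨ω, hω, rfl⟩ := cs.exists_isReduced w
    have hdesc : cs.IsRightDescent (cs.wordProd (i :: ω)) (ι a) := by
      simpa [IsRightDescent, wordProd_cons, mul_assoc] using hlt
    obtain ⟨k, hk, hk'⟩ := cs.exists_mul_simple_eq_eraseIdx hdesc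
    match k, hk, hk' with
    | 0, _, hk' =>
      apply h _ (cs.simple_mem_parabolic ι a)
      rw [List.eraseIdx_cons_zero, wordProd_cons] at hk'
      rwa [← eq_mul_inv_iff_mul_eq, inv_simple] at hk'
    | k + 1, hk, hk' =>
      rw [List.eraseIdx_cons_succ, wordProd_cons, wordProd_cons, mul_assoc, mul_right_inj] at hk'
      have h1 := cs.length_wordProd_le (ω.eraseIdx k)
      have h2 := List.length_eraseIdx_le ω k
      have h3 := hω.eq
      rw [← hk'] at h1
      simp only [List.map_cons, List.map_nil, wordProd_singleton, List.length_singleton] at hL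
      omega

end CoxeterSystem

/-! ### Alternating products -/

namespace VirtualArtin

theorem prodR_succ_left {G : Type*} [Monoid G] (b a : G) (m : ℕ) :
    prodR b a (m + 1) = (if Even m then a else b) * prodR b a m := by
  induction m generalizing a b with
  | zero => simp [prodR]
  | succ m ih =>
    rw [prodR, ih, mul_assoc, prodR]
    simp only [Nat.even_add_one, ite_not]

/-- Multiplication by the labels `c` of a sequence of steps whose nontrivial members sit at one
residue class modulo `N` and alternate between `a` and `b` produces alternating products: after `n`
steps the number of factors is `(n + r) / N`. -/
theorem prodR_add_one_div {G : Type*} [Monoid G] {b a c : G} {N r n : ℕ} (hN : 0 < N)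
    (h : ∀ q, n + r + 1 = (q + 1) * N → c = if Even q then a else b)
    (h' : ¬ N ∣ n + r + 1 → c = 1) :
    prodR b a ((n + 1 + r) / N) = c * prodR b a ((n + r) / N) := by
  rw [add_right_comm, Nat.succ_div]
  split_ifs with hd
  · obtain ⟨q, hq⟩ := hd
    have hq0 : q ≠ 0 := by
      rintro rfl
      simp at hq
    obtain ⟨q, rfl⟩ := Nat.exists_eq_succ_of_ne_zero hq0
    have hdiv : (n + r) / N = q := by
      have h3 : n + r = N * q + (N - 1) := by
        rw [Nat.mul_succ] at hq
        omega
      rw [h3, Nat.mul_add_div hN, Nat.div_eq_of_lt (by omega), add_zero]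
    rw [hdiv, prodR_succ_left, h q (by rw [hq, mul_comm])]
  · rw [h' hd, one_mul, add_zero]

end VirtualArtin

namespace CoxeterSystem

open VirtualArtin

variable {B W : Type*} [Group W] {M : CoxeterMatrix B} (cs : CoxeterSystem M W)

/-! ### Minimal coset representatives and their labels -/

section Cosets

variable {A : Type*} (ι : A → B)

theorem exists_isMinRep (C : W ⧸ cs.parabolic ι) :
    ∃ w : W, (w : W ⧸ cs.parabolic ι) = C ∧ cs.IsMinRep ι w := by
  obtain ⟨w, rfl⟩ := QuotientGroup.mk_surjective C
  obtain ⟨v, hv, hmin⟩ := exists_minimalFor_of_wellFoundedLT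
    (fun v : W => (v : W ⧸ cs.parabolic ι) = w) cs.length ⟨w, rfl⟩
  refine ⟨v, hv, fun p hp => ?_⟩
  by_contra hlt
  rw [not_le] at hlt
  have hvp : ((v * p : W) : W ⧸ cs.parabolic ι) = w := by
    rw [← hv, QuotientGroup.mk_mul_of_mem _ hp]
  exact absurd (hmin hvp hlt.le) (not_le.mpr hlt)

/-- The minimal length representative of a left coset of a standard parabolic subgroup. -/
noncomputable def minRep (C : W ⧸ cs.parabolic ι) : W := (cs.exists_isMinRep ι C).choose

@[simp]
theorem mk_minRep (C : W ⧸ cs.parabolic ι) : (cs.minRep ι C : W ⧸ cs.parabolic ι) = C :=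
  (cs.exists_isMinRep ι C).choose_spec.1

theorem isMinRep_minRep (C : W ⧸ cs.parabolic ι) : cs.IsMinRep ι (cs.minRep ι C) :=
  (cs.exists_isMinRep ι C).choose_spec.2

theorem IsMinRep.minRep_mk {w : W} (hw : cs.IsMinRep ι w) : cs.minRep ι w = w := by
  have hmem : w⁻¹ * cs.minRep ι w ∈ cs.parabolic ι := by
    rw [← QuotientGroup.eq, mk_minRep]
  have h : w * (w⁻¹ * cs.minRep ι w) = cs.minRep ι w := mul_inv_cancel_left _ _
  have := IsMinRep.eq_of_mem cs ι hw hmem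
    (by rw [h]; exact cs.isMinRep_minRep ι w)
  rwa [h] at this

theorem minRep_one : cs.minRep ι ((1 : W) : W ⧸ cs.parabolic ι) = 1 :=
  IsMinRep.minRep_mk cs ι fun p _ => by simp

theorem simple_smul_eq_mk (i : B) (C : W ⧸ cs.parabolic ι) :
    cs.simple i • C = ((cs.simple i * cs.minRep ι C : W) : W ⧸ cs.parabolic ι) := by
  conv_lhs => rw [← cs.mk_minRep ι C]
  rfl

theorem exists_simple_mul_minRep {i : B} {C : W ⧸ cs.parabolic ι} (h : cs.simple i • C = C) :
    ∃ a, cs.simple i * cs.minRep ι C = cs.minRep ι C * cs.simple (ι a) := by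
  have hmem : (cs.minRep ι C)⁻¹ * (cs.simple i * cs.minRep ι C) ∈ cs.parabolic ι := by
    rw [← QuotientGroup.eq, ← simple_smul_eq_mk, mk_minRep, h]
  exact IsMinRep.exists_simple_mul_eq cs ι (cs.isMinRep_minRep ι C) hmem
    (mul_inv_cancel_left _ _).symm

theorem minRep_simple_smul {i : B} {C : W ⧸ cs.parabolic ι} (h : cs.simple i • C ≠ C) :
    cs.minRep ι (cs.simple i • C) = cs.simple i * cs.minRep ι C := by
  rw [simple_smul_eq_mk]
  apply IsMinRep.minRep_mk
  apply IsMinRep.simple_mul cs ι (cs.isMinRep_minRep ι C)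
  intro p hp hsp
  apply h
  rw [simple_smul_eq_mk, hsp, QuotientGroup.mk_mul_of_mem _ hp, mk_minRep]

variable {G : Type*} [Group G] (e : A → G)

open scoped Classical in
/-- The label in `G` of the simple reflection `i` at the coset `C` with minimal representative
`w`: it is `e a` if `i` fixes `C`, where `s_i w = w s_{ι a}`, and `1` if `i` moves `C`. -/
noncomputable def label (i : B) (C : W ⧸ cs.parabolic ι) : G :=
  if h : cs.simple i • C = C then e (cs.exists_simple_mul_minRep ι h).choose else 1

theorem label_of_ne {i : B} {C : W ⧸ cs.parabolic ι} (h : cs.simple i • C ≠ C) :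
    cs.label ι e i C = 1 :=
  dif_neg h

theorem exists_label_eq {i : B} {C : W ⧸ cs.parabolic ι} (h : cs.simple i • C = C) :
    ∃ a, cs.simple i * cs.minRep ι C = cs.minRep ι C * cs.simple (ι a) ∧
      cs.label ι e i C = e a :=
  ⟨_, (cs.exists_simple_mul_minRep ι h).choose_spec, dif_pos h⟩

theorem simple_smul_smul (i : B) (C : W ⧸ cs.parabolic ι) :
    cs.simple i • cs.simple i • C = C := by
  rw [smul_smul, simple_mul_simple_self, one_smul]

theorem label_simple_smul (i : B) (C : W ⧸ cs.parabolic ι) :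
    cs.label ι e i (cs.simple i • C) = cs.label ι e i C := by
  by_cases h : cs.simple i • C = C
  · rw [h]
  · rw [label_of_ne _ _ _ h, label_of_ne]
    rw [simple_smul_smul]
    exact Ne.symm h

/-- The Artin generator `i` acting on `G × W ⧸ W_X`: it acts on the coset through the Coxeter group,
and multiplies the first component by its label at that coset. -/
noncomputable def labelPerm (i : B) : Equiv.Perm (G × (W ⧸ cs.parabolic ι)) where
  toFun x := (cs.label ι e i x.2 * x.1, cs.simple i • x.2)
  invFun x := ((cs.label ι e i x.2)⁻¹ * x.1, cs.simple i • x.2)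
  left_inv x := by simp [label_simple_smul, simple_smul_smul]
  right_inv x := by simp [label_simple_smul, simple_smul_smul]

theorem labelPerm_apply (i : B) (x : G × (W ⧸ cs.parabolic ι)) :
    cs.labelPerm ι e i x = (cs.label ι e i x.2 * x.1, cs.simple i • x.2) := rfl

end Cosets

/-! ### Alternating walks in a dihedral subgroup -/

section Walk

/-- The letter of the bi-infinite alternating word in `i` and `j` at position `n`: it is `i` at odd
positions and `j` at even ones. -/
def letter (i j : B) (n : ℤ) : B := if Even n then j else i

variable (i j : B)

/-- The alternating product leading from position `0` to position `n` of the bi-infinite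
alternating word; at negative `n` the word is read backwards. It equals `(s_j s_i) ^ (n / 2)`, with
one further factor `s_i` on the left if `n` is odd. -/
def walk (n : ℤ) : W :=
  (if Even n then 1 else cs.simple i) * (cs.simple i * cs.simple j) ^ (-(n / 2))

@[simp]
theorem walk_zero : cs.walk i j 0 = 1 := by simp [walk]

theorem walk_two_mul (k : ℤ) :
    cs.walk i j (2 * k) = (cs.simple i * cs.simple j) ^ (-k) := by
  simp [walk]

theorem walk_two_mul_add_one (k : ℤ) :
    cs.walk i j (2 * k + 1) = cs.simple i * (cs.simple i * cs.simple j) ^ (-k) := by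
  have h1 : ¬ Even (2 * k + 1) := by simp
  have h2 : (2 * k + 1) / 2 = k := by omega
  simp [walk, h1, h2]

theorem walk_add_one (n : ℤ) :
    cs.walk i j (n + 1) = cs.simple (letter i j (n + 1)) * cs.walk i j n := by
  rcases Int.even_or_odd' n with ⟨k, rfl | rfl⟩
  · have h : ¬ Even (2 * k + 1) := by simp
    rw [walk_two_mul_add_one, walk_two_mul, letter, if_neg h]
  · have h : Even (2 * k + 1 + 1) := by simp
    have h' : 2 * k + 1 + 1 = 2 * (k + 1) := by ring
    rw [letter, if_pos h, h', walk_two_mul_add_one, walk_two_mul, neg_add, add_comm, zpow_add,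
      zpow_neg_one, mul_inv_rev, inv_simple, inv_simple, mul_assoc]

theorem walk_sub_one (n : ℤ) :
    cs.walk i j (n - 1) = cs.simple (letter i j n) * cs.walk i j n := by
  have := cs.walk_add_one i j (n - 1)
  rw [sub_add_cancel] at this
  rw [this, simple_mul_simple_cancel_left]

/-- Two positions that are symmetric about the step from `n - 1` to `n` differ by a reflection that
depends on `n` only. -/
theorem walk_inv_mul_walk {a b n : ℤ} (h : a + b = 2 * n - 1) :
    (cs.walk i j b)⁻¹ * cs.walk i j a = (cs.simple i * cs.simple j) ^ (n - 1) * cs.simple i := by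
  have hs : ∀ k : ℤ, cs.simple i * (cs.simple i * cs.simple j) ^ k =
      (cs.simple i * cs.simple j) ^ (-k) * cs.simple i := by
    intro k
    have : SemiconjBy (cs.simple i) (cs.simple i * cs.simple j)
        (cs.simple i * cs.simple j)⁻¹ := by
      simp [SemiconjBy, mul_assoc]
    have h2 := this.zpow_right k
    rwa [inv_zpow'] at h2
  rcases Int.even_or_odd' a with ⟨k, rfl | rfl⟩
  · obtain ⟨l, rfl⟩ : ∃ l, b = 2 * l + 1 := ⟨n - 1 - k, by omega⟩
    rw [walk_two_mul_add_one, walk_two_mul, mul_inv_rev, inv_simple, mul_assoc, hs, ← zpow_neg,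
      ← mul_assoc, ← zpow_add]
    congr 2
    omega
  · obtain ⟨l, rfl⟩ : ∃ l, b = 2 * l := ⟨n - 1 - k, by omega⟩
    rw [walk_two_mul_add_one, walk_two_mul, hs, ← zpow_neg, ← mul_assoc, ← zpow_add]
    congr 2
    omega

theorem walk_neg_eq : cs.walk i j (-(M i j : ℤ)) = cs.walk i j (M i j) := by
  have hδ : (cs.simple i * cs.simple j) ^ (M i j : ℤ) = 1 := by
    rw [zpow_natCast, simple_mul_simple_pow]
  generalize (M i j : ℤ) = m at *
  rcases Int.even_or_odd' m with ⟨k, rfl | rfl⟩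
  · rw [← mul_neg, walk_two_mul, walk_two_mul, neg_neg, zpow_neg, eq_inv_iff_mul_eq_one,
      ← zpow_add, ← two_mul, hδ]
  · have h : -(2 * k + 1) = 2 * (-k - 1) + 1 := by ring
    rw [h, walk_two_mul_add_one, walk_two_mul_add_one, mul_right_inj, zpow_neg, zpow_neg,
      inv_inj, eq_comm, ← mul_inv_eq_one, ← zpow_sub, ← hδ]
    congr 1
    ring

end Walk

end CoxeterSystem

/-! ### The action of an Artin group on labelled cosets -/

namespace CoxeterSystem

open VirtualArtin

variable {B W : Type*} [Group W] {M : CoxeterMatrix B} (cs : CoxeterSystem M W)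
variable {A : Type*} (ι : A → B) {G : Type*} [Group G] (e : A → G) (i j : B)
  (C : W ⧸ cs.parabolic ι)

/-- The label met at step `n`, which joins the positions `n - 1` and `n`, of the alternating walk
through the cosets that passes through `C` at position `0`. -/
noncomputable def walkLabel (n : ℤ) : G := cs.label ι e (letter i j n) (cs.walk i j n • C)

theorem walk_sub_one_smul (n : ℤ) :
    cs.walk i j (n - 1) • C = cs.simple (letter i j n) • cs.walk i j n • C := by
  rw [walk_sub_one, mul_smul]

theorem walk_add_one_smul (n : ℤ) :
    cs.walk i j (n + 1) • C = cs.simple (letter i j (n + 1)) • cs.walk i j n • C := by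
  rw [walk_add_one, mul_smul]

theorem walkLabel_eq_label_sub_one (n : ℤ) :
    cs.walkLabel ι e i j C n = cs.label ι e (letter i j n) (cs.walk i j (n - 1) • C) := by
  rw [walk_sub_one_smul, label_simple_smul, walkLabel]

theorem prodR_labelPerm_apply {f : ℕ → G} (h0 : f 0 = 1)
    (hf : ∀ n : ℕ, f (n + 1) = cs.walkLabel ι e i j C (n + 1) * f n) (n : ℕ) (g : G) :
    prodR (cs.labelPerm ι e j) (cs.labelPerm ι e i) n (g, C) =
      (f n * g, cs.walk i j n • C) := by
  induction n with
  | zero => simp [prodR, h0]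
  | succ n ih =>
    have hl : (if Even n then cs.labelPerm ι e i else cs.labelPerm ι e j) =
        cs.labelPerm ι e (letter i j (n + 1)) := by
      have h' : Even ((n : ℤ) + 1) ↔ ¬ Even n := by
        rw [Int.even_add_one, Int.even_coe_nat]
      by_cases h : Even n <;> simp only [letter, h', h, not_true, not_false_iff, if_true, if_false]
    rw [prodR_succ_left, hl, Equiv.Perm.mul_apply, ih, labelPerm_apply, hf,
      walkLabel_eq_label_sub_one, add_sub_cancel_right, Nat.cast_succ, walk_add_one_smul,
      mul_assoc]

theorem prodR_labelPerm_apply_neg {f : ℕ → G} (h0 : f 0 = 1)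
    (hf : ∀ n : ℕ, f (n + 1) = cs.walkLabel ι e i j C (-n) * f n) (n : ℕ) (g : G) :
    prodR (cs.labelPerm ι e i) (cs.labelPerm ι e j) n (g, C) =
      (f n * g, cs.walk i j (-n) • C) := by
  induction n with
  | zero => simp [prodR, h0]
  | succ n ih =>
    have hl : (if Even n then cs.labelPerm ι e j else cs.labelPerm ι e i) =
        cs.labelPerm ι e (letter i j (-n)) := by
      by_cases h : Even n <;> simp [letter, h]
    rw [prodR_succ_left, hl, Equiv.Perm.mul_apply, ih, labelPerm_apply, hf, walkLabel,
      Nat.cast_succ, neg_add, ← sub_eq_add_neg, walk_sub_one_smul, mul_assoc]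

/-- Step `n` of the alternating walk stays at the same coset. -/
def IsLoop (n : ℤ) : Prop := cs.walk i j n • C = cs.walk i j (n - 1) • C

theorem walkLabel_of_not_isLoop {n : ℤ} (h : ¬ cs.IsLoop ι i j C n) :
    cs.walkLabel ι e i j C n = 1 := by
  apply label_of_ne
  rw [← walk_sub_one_smul]
  exact fun h' => h h'.symm

theorem isLoop_iff (n : ℤ) :
    cs.IsLoop ι i j C n ↔
      ((cs.simple i * cs.simple j) ^ (n - 1) * cs.simple i) • C = C := by
  rw [IsLoop, ← cs.walk_inv_mul_walk i j (a := n) (b := n - 1) (by ring), mul_smul,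
    inv_smul_eq_iff]

/-- The loops of an alternating walk form a single residue class. -/
theorem isLoop_iff_dvd {n₀ : ℤ} (h₀ : cs.IsLoop ι i j C n₀) (n : ℤ) :
    cs.IsLoop ι i j C n ↔
      (MulAction.period (cs.simple i * cs.simple j) C : ℤ) ∣ n - n₀ := by
  rw [← MulAction.zpow_smul_eq_iff_period_dvd]
  rw [isLoop_iff] at h₀ ⊢
  have h : (cs.simple i * cs.simple j) ^ (n - 1) * cs.simple i =
      (cs.simple i * cs.simple j) ^ (n - n₀) *
        ((cs.simple i * cs.simple j) ^ (n₀ - 1) * cs.simple i) := by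
    rw [← mul_assoc, ← zpow_add]
    congr 2
    ring
  rw [h, mul_smul, h₀]

/-- A walk is reflected by each of its loops. -/
theorem walkLabel_sub_of_isLoop {n : ℤ} (h : cs.IsLoop ι i j C n) (k : ℤ) :
    cs.walkLabel ι e i j C (n - k) = cs.walkLabel ι e i j C (n + k) := by
  rw [isLoop_iff, ← cs.walk_inv_mul_walk i j (a := n + k - 1) (b := n - k) (by ring), mul_smul,
    inv_smul_eq_iff] at h
  have hl : letter i j (n + k) = letter i j (n - k) := by
    simp [letter, Int.even_add, Int.even_sub]
  rw [walkLabel_eq_label_sub_one _ _ _ _ _ _ (n + k), h, hl, walkLabel]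

theorem walkLabel_add_two_mul {n N : ℤ} (h : cs.IsLoop ι i j C n)
    (h' : cs.IsLoop ι i j C (n + N)) :
    Function.Periodic (cs.walkLabel ι e i j C) (2 * N) := by
  intro k
  have h1 := cs.walkLabel_sub_of_isLoop ι e i j C h (k - n)
  have h2 := cs.walkLabel_sub_of_isLoop ι e i j C h' (k - n + N)
  have e1 : n + (k - n) = k := by ring
  have e2 : n + N + (k - n + N) = k + 2 * N := by ring
  have e3 : n + N - (k - n + N) = n - (k - n) := by ring
  rw [e1] at h1
  rw [e2, e3] at h2
  rw [← h2, h1]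

/-- Along a stretch without loops the minimal representatives follow the walk. -/
theorem minRep_walk_add {n : ℤ} (k : ℕ)
    (h : ∀ l : ℕ, 0 < l → l ≤ k → ¬ cs.IsLoop ι i j C (n + l)) :
    cs.minRep ι (cs.walk i j (n + k) • C) =
      cs.walk i j (n + k) * (cs.walk i j n)⁻¹ * cs.minRep ι (cs.walk i j n • C) := by
  induction k with
  | zero => simp
  | succ k ih =>
    have hk := h (k + 1) k.succ_pos le_rfl
    have he : n + ((k + 1 : ℕ) : ℤ) = n + k + 1 := by push_cast; ring
    rw [he] at hk ⊢
    rw [IsLoop, walk_add_one_smul, add_sub_cancel_right] at hk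
    rw [walk_add_one_smul, minRep_simple_smul _ _ hk,
      ih fun l hl hlk => h l hl (Nat.le_succ_of_le hlk), walk_add_one]
    simp only [mul_assoc]

/-- Two consecutive loops of a walk carry labels that satisfy the braid relation of length
`M i j / N`, where `N` is the distance between the loops. -/
theorem prodR_walkLabel_comm
    (he : ∀ a b, M (ι a) (ι b) ≠ 0 →
      prodR (e a) (e b) (M (ι a) (ι b)) = prodR (e b) (e a) (M (ι a) (ι b)))
    (hij : M i j ≠ 0) {n : ℤ} (hn : cs.IsLoop ι i j C n) {k : ℕ}
    (hk : M i j = k * MulAction.period (cs.simple i * cs.simple j) C) :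
    prodR (cs.walkLabel ι e i j C (n + MulAction.period (cs.simple i * cs.simple j) C))
        (cs.walkLabel ι e i j C n) k =
      prodR (cs.walkLabel ι e i j C n)
        (cs.walkLabel ι e i j C (n + MulAction.period (cs.simple i * cs.simple j) C)) k := by
  have hdvd := cs.isLoop_iff_dvd ι i j C hn
  set N := MulAction.period (cs.simple i * cs.simple j) C with hN
  have hN0 : N ≠ 0 := by
    rintro h
    rw [h, mul_zero] at hk
    exact hij hk
  have hk0 : k ≠ 0 := by
    rintro rfl
    rw [zero_mul] at hk
    exact hij hk
  have hn' : cs.IsLoop ι i j C (n + N) := by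
    rw [hdvd]
    simp
  have hfix : cs.simple (letter i j n) • cs.walk i j n • C = cs.walk i j n • C := by
    rw [← walk_sub_one_smul]
    exact hn.symm
  have hfix' : cs.simple (letter i j (n + N)) • cs.walk i j (n + N - 1) • C =
      cs.walk i j (n + N - 1) • C := by
    have h1 := cs.walk_add_one_smul ι i j C (n + N - 1)
    rw [sub_add_cancel] at h1
    rw [← h1]
    exact hn'
  obtain ⟨a, ha, hla⟩ := cs.exists_label_eq ι e hfix
  obtain ⟨b, hb, hlb⟩ := cs.exists_label_eq ι e hfix'
  rw [walkLabel_eq_label_sub_one _ _ _ _ _ _ (n + N), hlb, walkLabel, hla]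
  have hrep := cs.minRep_walk_add ι i j C (n := n) (N - 1) (by
    intro l hl hlN
    rw [hdvd, add_sub_cancel_left, Int.natCast_dvd_natCast]
    intro hd
    have := Nat.le_of_dvd hl hd
    omega)
  have hcast : n + ((N - 1 : ℕ) : ℤ) = n + N - 1 := by omega
  rw [hcast] at hrep
  set w := cs.minRep ι (cs.walk i j n • C) with hw
  rw [hrep] at hb
  have hord : M (ι a) (ι b) = k := by
    have hρ : ∀ l : ℤ, (cs.walk i j l)⁻¹ * cs.simple (letter i j l) * cs.walk i j l =
        (cs.simple i * cs.simple j) ^ (l - 1) * cs.simple i := by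
      intro l
      rw [← cs.walk_inv_mul_walk i j (a := l - 1) (b := l) (by ring), walk_sub_one, mul_assoc]
    have hρ' : ∀ l : ℤ, (cs.walk i j (l - 1))⁻¹ * cs.simple (letter i j l) * cs.walk i j (l - 1) =
        (cs.simple i * cs.simple j) ^ (l - 1) * cs.simple i := by
      intro l
      rw [walk_sub_one, ← hρ]
      simp [mul_assoc]
    obtain ⟨u, hu⟩ : ∃ u, u = w⁻¹ * cs.walk i j n := ⟨_, rfl⟩
    have hxa : cs.simple (ι a) =
        u * ((cs.simple i * cs.simple j) ^ (n - 1) * cs.simple i) * u⁻¹ := by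
      rw [← hρ, hu, eq_inv_mul_iff_mul_eq.mpr ha.symm]
      group
    have hxb : cs.simple (ι b) =
        u * ((cs.simple i * cs.simple j) ^ (n + N - 1) * cs.simple i) * u⁻¹ := by
      rw [← hρ', hu, eq_inv_mul_iff_mul_eq.mpr hb.symm]
      group
    have hxa' : cs.simple (ι a) =
        u * (cs.simple i * (cs.simple i * cs.simple j) ^ (1 - n)) * u⁻¹ := by
      rw [← inv_simple, hxa, ← neg_sub n 1, zpow_neg]
      simp [mul_assoc]
    have hprod : cs.simple (ι a) * cs.simple (ι b) =
        (u * cs.simple i) * (cs.simple i * cs.simple j) ^ N * (u * cs.simple i)⁻¹ := by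
      have hz : (cs.simple i * cs.simple j) ^ N =
          (cs.simple i * cs.simple j) ^ (1 - n) * (cs.simple i * cs.simple j) ^ (n + N - 1) := by
        rw [← zpow_add, ← zpow_natCast]
        congr 1
        ring
      rw [hz, hxa', hxb, mul_inv_rev (u) (cs.simple i), inv_simple]
      simp only [mul_assoc, inv_mul_cancel_left]
    have hconj : orderOf ((u * cs.simple i) * (cs.simple i * cs.simple j) ^ N *
        (u * cs.simple i)⁻¹) = orderOf ((cs.simple i * cs.simple j) ^ N) :=
      (orderOf_injective (MulAut.conj (u * cs.simple i)).toMonoidHom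
        (MulAut.conj (u * cs.simple i)).injective _)
    rw [← cs.orderOf_simple_mul_simple, hprod, hconj, orderOf_pow_of_dvd hN0,
      orderOf_simple_mul_simple, hk, Nat.mul_div_cancel _ (Nat.pos_of_ne_zero hN0)]
    rw [orderOf_simple_mul_simple, hk]
    exact dvd_mul_left N k
  have := he a b (by rw [hord]; exact hk0)
  rw [hord] at this
  exact this.symm

/-- The permutations `labelPerm` satisfy the Artin relations. -/
theorem prodR_labelPerm_comm
    (he : ∀ a b, M (ι a) (ι b) ≠ 0 →
      prodR (e a) (e b) (M (ι a) (ι b)) = prodR (e b) (e a) (M (ι a) (ι b)))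
    (hij : M i j ≠ 0) :
    prodR (cs.labelPerm ι e j) (cs.labelPerm ι e i) (M i j) =
      prodR (cs.labelPerm ι e i) (cs.labelPerm ι e j) (M i j) := by
  ext1 ⟨g, C⟩
  by_cases hloop : ∃ n, cs.IsLoop ι i j C n
  · obtain ⟨n₁, hn₁⟩ := hloop
    set N := MulAction.period (cs.simple i * cs.simple j) C with hN
    obtain ⟨k, hk⟩ : ∃ k, M i j = k * N := by
      have : N ∣ M i j := by
        rw [← cs.orderOf_simple_mul_simple]
        exact MulAction.period_dvd_orderOf _ _
      obtain ⟨k, hk⟩ := this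
      exact ⟨k, by rw [hk, mul_comm]⟩
    have hN0 : 0 < N := by
      apply Nat.pos_of_ne_zero
      rintro h
      rw [h, mul_zero] at hk
      exact hij hk
    -- The loop `n₀` with `1 ≤ n₀ ≤ N` is the first one met by the forward walk.
    obtain ⟨n₀, h1, h2, hn₀⟩ : ∃ n₀ : ℕ, 1 ≤ n₀ ∧ n₀ ≤ N ∧ cs.IsLoop ι i j C n₀ := by
      have hNz : (N : ℤ) ≠ 0 := by omega
      have h0 := Int.emod_nonneg (n₁ - 1) hNz
      have hlt := Int.emod_lt_of_pos (n₁ - 1) (by omega : (0 : ℤ) < N)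
      refine ⟨((n₁ - 1) % N).toNat + 1, by omega, by omega, ?_⟩
      rw [cs.isLoop_iff_dvd ι i j C hn₁, ← hN]
      refine ⟨-((n₁ - 1) / N), ?_⟩
      have := Int.emod_add_mul_ediv (n₁ - 1) N
      push_cast
      rw [Int.toNat_of_nonneg h0]
      linarith
    have hdvd := cs.isLoop_iff_dvd ι i j C hn₀
    rw [← hN] at hdvd
    have hn₀' : cs.IsLoop ι i j C (n₀ + N) := by
      rw [hdvd]
      simp
    have hper := cs.walkLabel_add_two_mul ι e i j C hn₀ hn₀'
    have hbraid := cs.prodR_walkLabel_comm ι e i j C he hij hn₀ hk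
    rw [← hN] at hbraid
    set x := cs.walkLabel ι e i j C n₀ with hx
    set y := cs.walkLabel ι e i j C (n₀ + N) with hy
    have heven : ∀ l : ℤ, Even l → cs.walkLabel ι e i j C (n₀ + l * N) = x := by
      rintro _ ⟨l, rfl⟩
      have := hper.int_mul l n₀
      rw [Int.cast_id] at this
      rw [hx, ← this]
      congr 1
      ring
    have hodd : ∀ l : ℤ, ¬ Even l → cs.walkLabel ι e i j C (n₀ + l * N) = y := by
      intro l hl
      obtain ⟨l, rfl⟩ := Int.not_even_iff_odd.mp hl
      have := hper.int_mul l (n₀ + N)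
      rw [Int.cast_id] at this
      rw [hy, ← this]
      congr 1
      ring
    -- After `n` steps the forward walk has met `(n + N - n₀) / N` loops.
    have hfwd := cs.prodR_labelPerm_apply ι e i j C
      (f := fun n => prodR y x ((n + (N - n₀)) / N))
      (by
        have : (0 + (N - n₀)) / N = 0 := Nat.div_eq_of_lt (by omega)
        simp only [this, prodR])
      (fun n => prodR_add_one_div hN0
        (fun q hq => by
          have hpos : (n + 1 : ℤ) = n₀ + q * N := by
            zify [h2] at hq
            linarith
          rw [hpos]
          by_cases hqe : Even q
          · rw [if_pos hqe, heven _ (by exact_mod_cast hqe)]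
          · rw [if_neg hqe, hodd _ (by exact_mod_cast hqe)])
        (fun hd => by
          apply cs.walkLabel_of_not_isLoop
          have hcast : ((n + 1 : ℤ) - n₀) = ((n + (N - n₀) + 1 : ℕ) : ℤ) - N := by
            push_cast [Nat.cast_sub h2]
            ring
          rwa [hdvd, hcast, dvd_sub_self_right, Int.natCast_dvd_natCast]))
      (M i j) g
    -- After `n` steps the backward walk has met `(n + n₀ - 1) / N` loops.
    have hbwd := cs.prodR_labelPerm_apply_neg ι e i j C
      (f := fun n => prodR x y ((n + (n₀ - 1)) / N))
      (by
        have : (0 + (n₀ - 1)) / N = 0 := Nat.div_eq_of_lt (by omega)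
        simp only [this, prodR])
      (fun n => prodR_add_one_div hN0
        (fun q hq => by
          have hpos : (-n : ℤ) = n₀ + (-(q + 1)) * N := by
            zify [h1] at hq
            linarith
          have heq : Even (-((q : ℤ) + 1)) ↔ ¬ Even q := by
            rw [even_neg, Int.even_add_one, Int.even_coe_nat]
          rw [hpos]
          by_cases hqe : Even q
          · rw [if_pos hqe, hodd _ (by rwa [heq, not_not])]
          · rw [if_neg hqe, heven _ (by rwa [heq])])
        (fun hd => by
          apply cs.walkLabel_of_not_isLoop
          have hcast : (-(n : ℤ) - n₀) = -((n + (n₀ - 1) + 1 : ℕ) : ℤ) := by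
            push_cast [Nat.cast_sub h1]
            ring
          rwa [hdvd, hcast, dvd_neg, Int.natCast_dvd_natCast]))
      (M i j) g
    have hk1 : (M i j + (N - n₀)) / N = k := by
      rw [hk, mul_comm, Nat.mul_add_div hN0, Nat.div_eq_of_lt (by omega), add_zero]
    have hk2 : (M i j + (n₀ - 1)) / N = k := by
      rw [hk, mul_comm, Nat.mul_add_div hN0, Nat.div_eq_of_lt (by omega), add_zero]
    rw [hfwd, hbwd, hk1, hk2, hbraid, walk_neg_eq]
  · push Not at hloop
    rw [cs.prodR_labelPerm_apply ι e i j C (f := fun _ => 1) rfl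
        (fun n => by rw [cs.walkLabel_of_not_isLoop ι e i j C (hloop _), one_mul]),
      cs.prodR_labelPerm_apply_neg ι e i j C (f := fun _ => 1) rfl
        (fun n => by rw [cs.walkLabel_of_not_isLoop ι e i j C (hloop _), one_mul]), walk_neg_eq]

end CoxeterSystem

namespace VirtualArtin

/-! ### Artin groups -/

theorem ArtinGroup.prodR_of {S : Type*} (M : CoxeterMatrix S) (s t : S) (hm : M s t ≠ 0) :
    prodR (PresentedGroup.of t : ArtinGroup M) (PresentedGroup.of s) (M s t) =
      prodR (PresentedGroup.of s : ArtinGroup M) (PresentedGroup.of t) (M s t) := by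
  by_cases hst : s = t
  · rw [hst]
  have h : PresentedGroup.mk (artinRelators M)
      (prodR (FreeGroup.of t) (FreeGroup.of s) (M s t) *
        (prodR (FreeGroup.of s) (FreeGroup.of t) (M s t))⁻¹) = 1 :=
    PresentedGroup.one_of_mem ⟨s, t, hst, hm, rfl⟩
  rw [map_mul, map_inv, map_prodR, map_prodR] at h
  exact mul_inv_eq_one.mp h

/-- The homomorphism out of an Artin group given by elements satisfying the Artin relations. -/
def ArtinGroup.lift {S : Type*} (M : CoxeterMatrix S) {G : Type*} [Group G] (f : S → G)
    (hf : ∀ s t, M s t ≠ 0 → prodR (f t) (f s) (M s t) = prodR (f s) (f t) (M s t)) :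
    ArtinGroup M →* G :=
  PresentedGroup.toGroup (f := f) (by
    rintro _ ⟨s, t, _, hm, rfl⟩
    rw [map_mul, map_inv, map_prodR, map_prodR, FreeGroup.lift_apply_of, FreeGroup.lift_apply_of,
      hf s t hm, mul_inv_cancel])

@[simp]
theorem ArtinGroup.lift_of {S : Type*} (M : CoxeterMatrix S) {G : Type*} [Group G] (f : S → G)
    (hf : ∀ s t, M s t ≠ 0 → prodR (f t) (f s) (M s t) = prodR (f s) (f t) (M s t)) (s : S) :
    ArtinGroup.lift M f hf (PresentedGroup.of s) = f s :=
  PresentedGroup.toGroup.of _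

/-- A map of vertex sets that preserves the entries of the Coxeter matrices induces a homomorphism
of Artin groups. -/
def ArtinGroup.map {S T : Type*} (M : CoxeterMatrix S) (N : CoxeterMatrix T) (ι : S → T)
    (hι : ∀ s t, N (ι s) (ι t) = M s t) : ArtinGroup M →* ArtinGroup N :=
  ArtinGroup.lift M (fun s => PresentedGroup.of (ι s)) fun s t hm => by
    rw [← hι]
    exact ArtinGroup.prodR_of N (ι s) (ι t) (by rwa [hι])

@[simp]
theorem ArtinGroup.map_of {S T : Type*} (M : CoxeterMatrix S) (N : CoxeterMatrix T) (ι : S → T)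
    (hι : ∀ s t, N (ι s) (ι t) = M s t) (s : S) :
    ArtinGroup.map M N ι hι (PresentedGroup.of s) = PresentedGroup.of (ι s) :=
  ArtinGroup.lift_of _ _ _ _

/-- Van der Lek's theorem: a standard parabolic subgroup of an Artin group is the Artin group of the
corresponding full subgraph. The group `ArtinGroup N` acts on `ArtinGroup M × W ⧸ W_X`, where `W` is
the Coxeter group of `N` and `W_X` the parabolic subgroup, and the image of `x` sends `(g, W_X)` to
`(x * g, W_X)`. -/
theorem ArtinGroup.map_injective {S T : Type*} (M : CoxeterMatrix S) (N : CoxeterMatrix T)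
    (ι : S → T) (hι : ∀ s t, N (ι s) (ι t) = M s t) :
    Function.Injective (ArtinGroup.map M N ι hι) := by
  set cs := N.toCoxeterSystem
  let e : S → ArtinGroup M := PresentedGroup.of
  have he : ∀ a b, N (ι a) (ι b) ≠ 0 →
      prodR (e a) (e b) (N (ι a) (ι b)) = prodR (e b) (e a) (N (ι a) (ι b)) := by
    intro a b hab
    rw [hι] at hab ⊢
    exact (ArtinGroup.prodR_of M a b hab).symm
  let act : ArtinGroup N →* Equiv.Perm (ArtinGroup M × (N.Group ⧸ cs.parabolic ι)) :=
    ArtinGroup.lift N (cs.labelPerm ι e) fun i j hij => cs.prodR_labelPerm_comm ι e i j he hij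
  let C₀ : N.Group ⧸ cs.parabolic ι := (1 : N.Group)
  have hgen : ∀ s g, act (PresentedGroup.of (ι s)) (g, C₀) =
      (PresentedGroup.of s * g, C₀) := by
    intro s g
    have hfix : cs.simple (ι s) • C₀ = C₀ := by
      rw [cs.simple_smul_eq_mk, cs.minRep_one, mul_one, QuotientGroup.eq, mul_one]
      exact inv_mem (cs.simple_mem_parabolic ι s)
    obtain ⟨a, ha, hl⟩ := cs.exists_label_eq ι e hfix
    rw [cs.minRep_one, mul_one, one_mul] at ha
    have hsa : s = a := by
      by_contra hne
      apply M.off_diagonal s a hne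
      rw [← hι, cs.simple_injective ha, N.diagonal]
    subst hsa
    simp only [act, ArtinGroup.lift_of, CoxeterSystem.labelPerm_apply, hfix, hl]
    rfl
  have hact : ∀ x g, act (ArtinGroup.map M N ι hι x) (g, C₀) =
      (x * g, C₀) := by
    intro x
    induction x using PresentedGroup.induction_on with
    | _ z =>
      induction z using FreeGroup.induction_on with
      | C1 => simp
      | of s =>
        intro g
        exact (congrArg (fun y => act y _) (ArtinGroup.map_of M N ι hι s)).trans (hgen s g)
      | inv_of s ih =>
        intro g
        rw [map_inv, map_inv, map_inv, Equiv.Perm.inv_eq_iff_eq, ih, mul_inv_cancel_left]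
      | mul x y hx hy =>
        intro g
        rw [map_mul, map_mul, map_mul, Equiv.Perm.mul_apply, hy, hx, mul_assoc]
  intro x y hxy
  have hx := hact x 1
  rw [hxy, hact y 1] at hx
  simpa using (congrArg Prod.fst hx).symm

/-! ### The Artin group of the involutions of a group -/

/-- The Coxeter matrix on the elements of order at most two of a group `W`, whose entries are the
orders of the products of pairs; infinite order is encoded by `0`. -/
noncomputable def involutionMatrix (W : Type*) [Group W] : CoxeterMatrix {r : W // r * r = 1} where
  M r r' := orderOf (r.1 * r'.1)
  isSymm := by
    refine Matrix.IsSymm.ext fun r r' => ?_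
    have hr := mul_eq_one_iff_inv_eq.mp r.2
    have hr' := mul_eq_one_iff_inv_eq.mp r'.2
    rw [← orderOf_inv, mul_inv_rev, hr, hr']
  diagonal r := by rw [r.2, orderOf_one]
  off_diagonal r r' h h1 := by
    apply h
    ext1
    rw [orderOf_eq_one_iff, mul_eq_one_iff_eq_inv] at h1
    rw [h1, mul_eq_one_iff_inv_eq.mp r'.2]

theorem involutionMatrix_apply {W : Type*} [Group W] (r r' : {r : W // r * r = 1}) :
    involutionMatrix W r r' = orderOf (r.1 * r'.1) := rfl

/-- Conjugation by `w` on the elements of order at most two. -/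
def conjInvolution {W : Type*} [Group W] (w : W) (r : {r : W // r * r = 1}) :
    {r : W // r * r = 1} :=
  ⟨w * r.1 * w⁻¹, by
    rw [← MulAut.conj_apply, ← map_mul, r.2, map_one]⟩

@[simp]
theorem conjInvolution_one {W : Type*} [Group W] (r : {r : W // r * r = 1}) :
    conjInvolution 1 r = r := by
  simp [conjInvolution]

theorem conjInvolution_mul {W : Type*} [Group W] (w w' : W) (r : {r : W // r * r = 1}) :
    conjInvolution (w * w') r = conjInvolution w (conjInvolution w' r) := by
  simp [conjInvolution, mul_assoc]

theorem involutionMatrix_conj {W : Type*} [Group W] (w : W) (r r' : {r : W // r * r = 1}) :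
    involutionMatrix W (conjInvolution w r) (conjInvolution w r') = involutionMatrix W r r' := by
  have h : (conjInvolution w r).1 * (conjInvolution w r').1 = MulAut.conj w (r.1 * r'.1) := by
    simp [conjInvolution]
  rw [involutionMatrix_apply, involutionMatrix_apply, h]
  exact orderOf_injective (MulAut.conj w).toMonoidHom (MulAut.conj w).injective _

/-- The endomorphism of the Artin group of `involutionMatrix W` that conjugates the generators
by `w`. -/
noncomputable def conjArtinHom {W : Type*} [Group W] (w : W) :
    ArtinGroup (involutionMatrix W) →* ArtinGroup (involutionMatrix W) :=
  ArtinGroup.map _ _ (conjInvolution w) (involutionMatrix_conj w)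

theorem conjArtinHom_one (W : Type*) [Group W] :
    conjArtinHom (1 : W) = MonoidHom.id _ := by
  refine PresentedGroup.ext fun r => ?_
  simp [conjArtinHom]

theorem conjArtinHom_mul {W : Type*} [Group W] (w w' : W) :
    conjArtinHom (w * w') = (conjArtinHom w).comp (conjArtinHom w') := by
  refine PresentedGroup.ext fun r => ?_
  simp [conjArtinHom, conjInvolution_mul]

/-- The action of `W` by automorphisms on the Artin group of `involutionMatrix W`, which permutes
the generators by conjugation. -/
noncomputable def conjArtin (W : Type*) [Group W] :
    W →* MulAut (ArtinGroup (involutionMatrix W)) where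
  toFun w := MonoidHom.toMulEquiv (conjArtinHom w) (conjArtinHom w⁻¹)
    (by rw [← conjArtinHom_mul, inv_mul_cancel, conjArtinHom_one])
    (by rw [← conjArtinHom_mul, mul_inv_cancel, conjArtinHom_one])
  map_one' := by
    ext x
    exact DFunLike.congr_fun (conjArtinHom_one W) x
  map_mul' w w' := by
    ext x
    exact DFunLike.congr_fun (conjArtinHom_mul w w') x

theorem conjArtin_of {W : Type*} [Group W] (w : W) (r : {r : W // r * r = 1}) :
    conjArtin W w (PresentedGroup.of r) = PresentedGroup.of (conjInvolution w r) :=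
  ArtinGroup.map_of _ _ _ (involutionMatrix_conj w) r

/-! ### The virtual Artin group -/

variable {S : Type*} (M : CoxeterMatrix S)

/-- A simple reflection as an element of order at most two of the Coxeter group. -/
def simpleInvolution (s : S) : {r : M.Group // r * r = 1} :=
  ⟨M.toCoxeterSystem.simple s, M.toCoxeterSystem.simple_mul_simple_self s⟩

theorem involutionMatrix_simple (s t : S) :
    involutionMatrix M.Group (simpleInvolution M s) (simpleInvolution M t) = M s t :=
  M.toCoxeterSystem.orderOf_simple_mul_simple s t

theorem wordProd_alternatingWord {W : Type*} [Group W] (cs : CoxeterSystem M W) (s t : S) (m : ℕ) :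
    cs.wordProd (CoxeterSystem.alternatingWord s t m) = prodR (cs.simple s) (cs.simple t) m := by
  induction m generalizing s t with
  | zero => simp [CoxeterSystem.alternatingWord, prodR]
  | succ m ih => rw [CoxeterSystem.alternatingWord_succ, cs.wordProd_concat, ih, prodR]

theorem prodR_simple {W : Type*} [Group W] (cs : CoxeterSystem M W) (s t : S) :
    prodR (cs.simple t) (cs.simple s) (M s t) = prodR (cs.simple s) (cs.simple t) (M s t) := by
  have h := cs.wordProd_braidWord_eq s t
  rw [CoxeterSystem.braidWord, CoxeterSystem.braidWord, wordProd_alternatingWord,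
    wordProd_alternatingWord, M.symmetric t s] at h
  exact h.symm

/-- The mixed relation of the virtual Artin group, read in the Coxeter group: conjugation by an
alternating product of length `M s t - 1` takes `s` to `s` or `t`, depending on parity. -/
theorem conjInvolution_prodR {s t : S} (hm : M s t ≠ 0) :
    conjInvolution (prodR (M.toCoxeterSystem.simple s) (M.toCoxeterSystem.simple t) (M s t - 1))
      (simpleInvolution M s) = simpleInvolution M (if Even (M s t) then s else t) := by
  have h := prodR_simple M M.toCoxeterSystem s t
  obtain ⟨m, hm⟩ := Nat.exists_eq_succ_of_ne_zero hm
  rw [hm, prodR, prodR_succ_left] at h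
  ext1
  rw [hm, conjInvolution, Nat.succ_sub_one, mul_inv_eq_iff_eq_mul]
  refine h.trans ?_
  simp only [simpleInvolution, Nat.succ_eq_add_one, Nat.even_add_one]
  by_cases he : Even m <;> simp [he]

/-- The images of the generators of the virtual Artin group in the semidirect product of the Artin
group of `involutionMatrix W` by the Coxeter group `W`: the `σ_s` go to Artin generators, and the
`τ_s` to simple reflections. -/
noncomputable def genToSemidirect :
    Gen S → ArtinGroup (involutionMatrix M.Group) ⋊[conjArtin M.Group] M.Group
  | .sigma s => SemidirectProduct.inl (PresentedGroup.of (simpleInvolution M s))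
  | .tau s => SemidirectProduct.inr (M.toCoxeterSystem.simple s)

theorem lift_genToSemidirect (r : FreeGroup (Gen S)) (hr : VirtualArtinRelator M r) :
    FreeGroup.lift (genToSemidirect M) r = 1 := by
  induction hr with
  | artin s t hst hm =>
    have h := ArtinGroup.prodR_of (involutionMatrix M.Group) (simpleInvolution M s)
      (simpleInvolution M t)
    rw [involutionMatrix_simple] at h
    rw [map_mul, map_inv, map_prodR, map_prodR, mul_inv_eq_one]
    simp only [fsigma, FreeGroup.lift_apply_of, genToSemidirect, ← map_prodR, h hm]
  | coxeter s t hst hm =>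
    rw [map_mul, map_inv, map_prodR, map_prodR, mul_inv_eq_one]
    simp only [ftau, FreeGroup.lift_apply_of, genToSemidirect, ← map_prodR, prodR_simple]
  | square s =>
    rw [map_pow, ftau, FreeGroup.lift_apply_of, genToSemidirect, ← map_pow,
      M.toCoxeterSystem.simple_sq, map_one]
  | mixed s t hst hm =>
    rw [map_mul, map_inv, map_mul, map_mul, map_prodR, mul_inv_eq_one]
    simp only [ftau, fsigma, FreeGroup.lift_apply_of, genToSemidirect, ← map_prodR]
    rw [← mul_inv_eq_iff_eq_mul, ← map_inv, ← SemidirectProduct.inl_aut, conjArtin_of,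
      conjInvolution_prodR M hm]

/-- The homomorphism from the virtual Artin group of `M` to the semidirect product. -/
noncomputable def toSemidirect : VirtualArtinGroup M →*
    ArtinGroup (involutionMatrix M.Group) ⋊[conjArtin M.Group] M.Group :=
  PresentedGroup.toGroup (f := genToSemidirect M) (lift_genToSemidirect M)

theorem toSemidirect_comp_iotaA :
    (toSemidirect M).comp (iotaA M) = SemidirectProduct.inl.comp
      (ArtinGroup.map M _ (simpleInvolution M) (involutionMatrix_simple M)) := by
  refine PresentedGroup.ext fun s => ?_
  rw [MonoidHom.comp_apply, iotaA_of, MonoidHom.comp_apply, ArtinGroup.map_of]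
  exact PresentedGroup.toGroup.of _

end VirtualArtin

theorem corollary2p4 {S : Type*} [Countable S] (M : CoxeterMatrix S) :
    Function.Injective (VirtualArtin.iotaA M) := by
  have h : Function.Injective ((VirtualArtin.toSemidirect M).comp (VirtualArtin.iotaA M)) := by
    rw [VirtualArtin.toSemidirect_comp_iotaA]
    exact SemidirectProduct.inl_injective.comp (VirtualArtin.ArtinGroup.map_injective _ _ _ _)
  rw [MonoidHom.coe_comp] at h
  exact h.of_comp
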